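/- Let $\gamma>0$ and $\kappa>0$. There is a constant $c>0$, depending only on $\gamma$ and $\kappa$, with the following property. Let $E\subset\mathbb R^2$ be a polygon, i.e. a bounded connected open set that is the interior of its closure and whose boundary is a finite union of line segments, and suppose that $E$ admits a subtriangulation $\mathcal T$ (a finite set of nondegenerate closed triangles with pairwise disjoint interiors and union $\overline E$) that is shape regular and whose triangles have diameter comparable to that of $E$: every $T\in\mathcal T$ is star-shaped with respect to a ball of radius at least $\gamma h_T$, and $\kappa h_E\le h_T$, where $h_\omega=\operatorname{diam}(\omega)$ (the bound $h_T\le h_E$ is automatic). Then, for every $p\in\mathbb N=\{0,1,2,\dots\}$ and every real polynomial $q$ in two variables of total degree at most $p$, $$\|q\|_{0,E}\le c\,\frac{(p+1)^2}{h_E}\,\|q\|_{-1,E},\qquad \|q\|_{-1,E}:=\sup_{\Phi\in H^1_0(E)\setminus\{0\}}\frac{(q,\Phi)_{0,E}}{|\Phi|_{1,E}}.$$ Here $\|\cdot\|_{0,E}$ and $(\cdot,\cdot)_{0,E}$ are the norm and the inner product of $L^2(E)$, $|\Phi|_{1,E}=\|\nabla\Phi\|_{0,E}$, and $H^1_0(E)$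 is the closure of $C_c^\infty(E)$ in $H^1(E)$. -/

import Mathlib

open MeasureTheory Filter Topology Set
open scoped ENNReal ContDiff Gradient

namespace InverseEstimate

/-- The Euclidean plane. -/
abbrev Plane := EuclideanSpace ℝ (Fin 2)

/-- `E` is (the open region of) a polygon: a bounded connected open set that is equal to the interior
of its closure (no slits) and whose boundary consists of finitely many line segments.
Polygons may be non-convex, and may have holes. -/
structure IsPolygon (E : Set Plane) : Prop where
  isOpen : IsOpen E
  isBounded : Bornology.IsBounded E
  isConnected : IsConnected E
  interior_closure : interior (closure E) = E
  frontier_eq : ∃ s : Finset (Plane × Plane), frontier E = ⋃ e ∈ s, segment ℝ e.1 e.2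

/-- The closed triangle with the vertices of `T`. A term of `Affine.Triangle` has affinely
independent vertices, so the triangle is nondegenerate. -/
def region (T : Affine.Triangle ℝ Plane) : Set Plane :=
  convexHull ℝ (Set.range T.points)

/-- The finite family `𝒯` of triangles is a subtriangulation of `E`: the closed triangles cover
exactly the closed polygon, and two different triangles do not overlap. In particular every
conforming triangulation qualifies; conformity itself is not required. -/
structure IsSubtriangulation (𝒯 : Finset (Affine.Triangle ℝ Plane)) (E : Set Plane) : Prop where
  cover : ⋃ T ∈ 𝒯, region T = closure E
  nonoverlapping : (𝒯 : Set (Affine.Triangle ℝ Plane)).Pairwise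
    fun S T => Disjoint (interior (region S)) (interior (region T))

/-- `A` is star-shaped with respect to (every point of) some ball of radius at least `ρ`. -/
def IsStarShapedWrtBall (A : Set Plane) (ρ : ℝ) : Prop :=
  ∃ (z : Plane) (r : ℝ), ρ ≤ r ∧ ∀ y ∈ Metric.ball z r, y ∈ A ∧ StarConvex ℝ y A

/-- `φ ∈ C_c^∞(E)`. -/
def IsTestFunction (E : Set Plane) (φ : Plane → ℝ) : Prop :=
  ContDiff ℝ ∞ φ ∧ HasCompactSupport φ ∧ tsupport φ ⊆ E

/-- `u ∈ H¹(E)`, with weak gradient `G`. -/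
structure MemH1 (E : Set Plane) (u : Plane → ℝ) (G : Plane → Plane) : Prop where
  memLp : MemLp u 2 (volume.restrict E)
  memLp_grad : MemLp G 2 (volume.restrict E)
  weak_grad : ∀ φ : Plane → ℝ, IsTestFunction E φ →
    ∫ x in E, u x • ∇ φ x = - ∫ x in E, φ x • G x

/-- `u ∈ H¹₀(E)`, with weak gradient `G`: `u` belongs to the closure of `C_c^∞(E)` in `H¹(E)`. -/
structure MemH10 (E : Set Plane) (u : Plane → ℝ) (G : Plane → Plane) : Prop where
  memH1 : MemH1 E u G
  approx : ∃ φ : ℕ → Plane → ℝ, (∀ n, IsTestFunction E (φ n)) ∧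
    Tendsto (fun n => eLpNorm (fun x => φ n x - u x) 2 (volume.restrict E)) atTop (𝓝 0) ∧
    Tendsto (fun n => eLpNorm (fun x => ∇ (φ n) x - G x) 2 (volume.restrict E)) atTop (𝓝 0)

/-- The `L²(E)` norm `‖f‖_{0,E}`. -/
noncomputable def l2Norm (E : Set Plane) (f : Plane → ℝ) : ℝ≥0∞ :=
  eLpNorm f 2 (volume.restrict E)

/-- The dual norm `‖f‖_{-1,E} = sup (f, Φ)_{0,E} / |Φ|_{1,E}` over the nonzero `Φ ∈ H¹₀(E)`, where
`|Φ|_{1,E}` is the `L²(E)` norm of the weak gradient `G` of `Φ`. Negative quotients, for which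
`ENNReal.ofReal` is `0`, do not contribute to the supremum, because `-Φ` competes with `Φ`. -/
noncomputable def negNorm (E : Set Plane) (f : Plane → ℝ) : ℝ≥0∞ :=
  ⨆ (Φ : Plane → ℝ) (G : Plane → Plane) (_ : MemH10 E Φ G)
    (_ : ¬ Φ =ᵐ[volume.restrict E] 0),
    ENNReal.ofReal (∫ x in E, f x * Φ x) / eLpNorm G 2 (volume.restrict E)

/-- The function on the plane given by a polynomial in two variables. -/
noncomputable def polyFun (q : MvPolynomial (Fin 2) ℝ) (x : Plane) : ℝ :=
  MvPolynomial.eval (fun i => x i) q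

end InverseEstimate

namespace InverseEstimate

/-! It suffices to exhibit one good test function per piece of $E$. On a parallelogram
$P\subset\overline E$ with open interior in $E$, take $\Phi=\chi q$, where $\chi$ is a product of
smooth cutoffs that drop to zero in boundary layers of relative width $\sim(p+1)^{-2}$. If $\int
q\Phi\ge\frac12\|q\|_{0,P}^2$ and $|\Phi|_1\le L\|q\|_{0,P}$ with $L\sim(p+1)^2/\rho$, where $\rho$
measures the thickness of $P$, then testing gives $\|q\|_{0,P}\le2L\|q\|_{-1,E}$.

Both properties reduce, by Fubini along the sides of $P$, to facts on $(0,1)$. A polynomial of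
degree at most $p$ has little $L^2$ mass in such layers (`integral_sq_le_integral_inner`), because
its maximum is at most $\sqrt2(p+1)$ times its $L^2$ norm. Its derivative obeys the Markov
inequality with factor $\sim(p+1)^2$ (`integral_derivative_sq_le`). Both rest on Legendre
orthogonality.

A triangle is covered by its three corner parallelograms, which are spanned by half edges; an
inscribed ball bounds their thickness from below. The number of triangles is at most
$(\gamma\kappa)^{-2}$ by comparison of areas, so the squared local estimates may be summed, each
against the full dual norm on $E$. -/

open Polynomial in
/-- Integration of polynomials over the unit interval. -/
noncomputable def unitIntegral : ℝ[X] →ₗ[ℝ] ℝ where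
  toFun p := ∫ x in (0 : ℝ)..1, p.eval x
  map_add' p q := by
    simp only [eval_add]
    exact intervalIntegral.integral_add (p.continuous.intervalIntegrable _ _)
      (q.continuous.intervalIntegrable _ _)
  map_smul' c p := by simp

/-! ### Polynomial inequalities in $L^2(0,1)$ -/

section Univariate

open Polynomial

theorem unitIntegral_apply (p : ℝ[X]) : unitIntegral p = ∫ x in (0 : ℝ)..1, p.eval x := rfl

theorem unitIntegral_derivative (p : ℝ[X]) :
    unitIntegral (derivative p) = p.eval 1 - p.eval 0 :=
  intervalIntegral.integral_eq_sub_of_hasDerivAt (fun x _ => p.hasDerivAt x)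
    (p.derivative.continuous.intervalIntegrable _ _)

theorem unitIntegral_sq_nonneg (p : ℝ[X]) : 0 ≤ unitIntegral (p ^ 2) := by
  rw [unitIntegral_apply]
  refine intervalIntegral.integral_nonneg zero_le_one fun x _ => ?_
  simp only [eval_pow]
  positivity

theorem eq_zero_of_unitIntegral_mul_self (p : ℝ[X]) (h : unitIntegral (p * p) = 0) : p = 0 := by
  have h0 : ∀ x ∈ Icc (0 : ℝ) 1, p.eval x = 0 := by
    by_contra! hx
    obtain ⟨x, hx, hpx⟩ := hx
    have : 0 < ∫ x in (0 : ℝ)..1, (p * p).eval x := by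
      refine intervalIntegral.integral_pos zero_lt_one (p * p).continuous.continuousOn
        (fun y _ => ?_) ⟨x, hx, ?_⟩
      · simp only [eval_mul]
        exact mul_self_nonneg _
      · simp only [eval_mul]
        exact mul_self_pos.mpr hpx
    exact this.ne' h
  exact p.eq_zero_of_infinite_isRoot ((Icc_infinite zero_lt_one).mono h0)

/-- Orthogonal decomposition in `L²(0,1)` with respect to the polynomials of degree `< n`. -/
theorem exists_orthogonal_decomposition (n : ℕ) (q : ℝ[X]) :
    ∃ r ∈ degreeLT ℝ n, ∀ g ∈ degreeLT ℝ n, unitIntegral ((q - r) * g) = 0 := by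
  have : FiniteDimensional ℝ (degreeLT ℝ n) :=
    (degreeLTEquiv ℝ n).symm.finiteDimensional
  let B : ℝ[X] →ₗ[ℝ] Module.Dual ℝ (degreeLT ℝ n) :=
    ((LinearMap.mul ℝ ℝ[X]).compr₂ unitIntegral).compl₂ (degreeLT ℝ n).subtype
  have hB : ∀ (f : ℝ[X]) (g : degreeLT ℝ n), B f g = unitIntegral (f * g) := fun f g => rfl
  -- The pairing is definite on a finite-dimensional space, hence identifies it with its dual; `r`
  -- represents the functional that `q` induces.
  have hinj : Function.Injective (B ∘ₗ (degreeLT ℝ n).subtype) := by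
    rw [← LinearMap.ker_eq_bot, LinearMap.ker_eq_bot']
    intro r hr
    have := congrArg (fun f => f r) hr
    simp only [LinearMap.comp_apply, Submodule.subtype_apply, hB, LinearMap.zero_apply] at this
    exact Subtype.ext (eq_zero_of_unitIntegral_mul_self _ this)
  have hsurj := (LinearMap.injective_iff_surjective_of_finrank_eq_finrank
    Subspace.dual_finrank_eq.symm).mp hinj
  obtain ⟨r, hr⟩ := hsurj (B q)
  refine ⟨r, r.2, fun g hg => ?_⟩
  have := congrArg (fun f => f ⟨g, hg⟩) hr
  simp only [LinearMap.comp_apply, Submodule.subtype_apply, hB] at this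
  rw [sub_mul, map_sub, this, sub_self]

theorem mem_degreeLT_iff_coeff {n : ℕ} {q : ℝ[X]} :
    q ∈ degreeLT ℝ n ↔ ∀ m, n ≤ m → q.coeff m = 0 := by
  rw [mem_degreeLT, degree_lt_iff_coeff_zero]

theorem unitIntegral_sq_add {r s : ℝ[X]} (h : unitIntegral (s * r) = 0) :
    unitIntegral ((r + s) ^ 2) = unitIntegral (r ^ 2) + unitIntegral (s ^ 2) := by
  have : (r + s) ^ 2 = r ^ 2 + s ^ 2 + (2 : ℝ) • (s * r) := by
    rw [smul_eq_C_mul, C_ofNat]; ring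
  rw [this, map_add, map_add, map_smul, h, smul_zero, add_zero]

/-- Such an $s$ is a multiple of the shifted Legendre polynomial of degree $n$. The leading terms of
$xs'-ns$ cancel, so it is orthogonal to $s$; integrating $(xs^2)'=(2n+1)s^2+2s(xs'-ns)$ then gives
the identity. -/
theorem eval_one_sq_of_orthogonal {n : ℕ} {s : ℝ[X]} (hs : s ∈ degreeLT ℝ (n + 1))
    (h : ∀ g ∈ degreeLT ℝ n, unitIntegral (s * g) = 0) :
    s.eval 1 ^ 2 = (2 * n + 1) * unitIntegral (s ^ 2) := by
  have hmem : X * derivative s - (n : ℝ) • s ∈ degreeLT ℝ n := by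
    rw [mem_degreeLT_iff_coeff] at hs ⊢
    intro m hm
    rcases hm.eq_or_lt with rfl | hm
    · cases n with
      | zero => simp
      | succ k => simp [coeff_X_mul, coeff_derivative]; ring
    · cases m with
      | zero => omega
      | succ k => simp [coeff_X_mul, coeff_derivative, hs (k + 1) (by omega)]
  have hd : derivative (X * s ^ 2) = (2 * n + 1 : ℝ) • s ^ 2
      + (2 : ℝ) • (s * (X * derivative s - (n : ℝ) • s)) := by
    simp only [derivative_mul, derivative_X, derivative_pow, smul_eq_C_mul, map_add, map_mul,
      C_ofNat, map_one, map_natCast]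
    push_cast
    ring
  have := unitIntegral_derivative (X * s ^ 2)
  rw [hd, map_add, map_smul, map_smul, h _ hmem] at this
  simpa using this.symm

/-- The value at an endpoint is bounded by the `L²(0,1)` norm. -/
theorem eval_one_sq_le (n : ℕ) : ∀ q ∈ degreeLT ℝ n,
    q.eval 1 ^ 2 ≤ (n : ℝ) ^ 2 * unitIntegral (q ^ 2) := by
  induction n with
  | zero =>
    intro q hq
    have : q = 0 := by
      ext m; exact mem_degreeLT_iff_coeff.mp hq m (Nat.zero_le _)
    simp [this]
  | succ n ih =>
    intro q hq
    obtain ⟨r, hr, horth⟩ := exists_orthogonal_decomposition n q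
    obtain ⟨s, rfl⟩ : ∃ s, q = r + s := ⟨q - r, by ring⟩
    rw [add_sub_cancel_left] at horth
    have hs : s ∈ degreeLT ℝ (n + 1) := by
      have := Submodule.sub_mem _ hq (degreeLT_mono n.le_succ hr)
      rwa [add_sub_cancel_left] at this
    have h1 := ih r hr
    have h2 := eval_one_sq_of_orthogonal hs horth
    have h3 := unitIntegral_sq_nonneg r
    have h4 := unitIntegral_sq_nonneg s
    rw [unitIntegral_sq_add (horth r hr), eval_add]
    push_cast
    set a := r.eval 1
    set b := s.eval 1
    set A := unitIntegral (r ^ 2)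
    set B := unitIntegral (s ^ 2)
    -- The mixed term of Cauchy–Schwarz with weights $n^2$ and $2n+1$, which add up to $(n+1)^2$.
    have h5 : (2 * (a * b)) ≤ (2 * n + 1) * A + n ^ 2 * B := by
      have hn : (0 : ℝ) ≤ n := n.cast_nonneg
      have hAB : 0 ≤ (2 * n + 1) * A + n ^ 2 * B := by positivity
      refine abs_le_of_sq_le_sq' ?_ hAB |>.2
      have : (2 * (a * b)) ^ 2 ≤ 4 * (n ^ 2 * A * ((2 * n + 1) * B)) := by
        have : a ^ 2 * b ^ 2 ≤ (n ^ 2 * A) * ((2 * n + 1) * B) := by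
          rw [h2]; gcongr
        nlinarith
      nlinarith [sq_nonneg ((2 * n + 1) * A - n ^ 2 * B)]
    nlinarith

/-- Integration by parts for the Legendre operator $f\mapsto-((x-x^2)f')'$; the weight vanishes at
both endpoints. -/
theorem unitIntegral_weight_mul (f g : ℝ[X]) :
    unitIntegral ((X - X ^ 2) * derivative f * derivative g) =
      unitIntegral (-derivative ((X - X ^ 2) * derivative f) * g) := by
  have h := unitIntegral_derivative ((X - X ^ 2) * derivative f * g)
  rw [derivative_mul, map_add] at h
  simp only [eval_mul, eval_sub, eval_X, eval_pow] at h
  rw [neg_mul, map_neg]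
  linarith

/-- In the monomial basis the Legendre operator is triangular, with diagonal entries $m(m+1)$, its
eigenvalues. -/
theorem coeff_legendre (f : ℝ[X]) (m : ℕ) :
    (-derivative ((X - X ^ 2) * derivative f)).coeff m =
      m * (m + 1) * f.coeff m - (m + 1) ^ 2 * f.coeff (m + 1) := by
  rw [sub_mul, pow_two, mul_assoc, coeff_neg, coeff_derivative, coeff_sub, coeff_X_mul, coeff_X_mul]
  cases m with
  | zero => simp [coeff_derivative]
  | succ k => simp [coeff_X_mul, coeff_derivative]; ring

theorem legendre_mem_degreeLT {n : ℕ} {f : ℝ[X]} (hf : f ∈ degreeLT ℝ n) :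
    -derivative ((X - X ^ 2) * derivative f) ∈ degreeLT ℝ n := by
  rw [mem_degreeLT_iff_coeff] at hf ⊢
  intro m hm
  rw [coeff_legendre, hf m hm, hf (m + 1) (by omega)]
  ring

theorem unitIntegral_weight_sq_of_orthogonal {n : ℕ} {s : ℝ[X]} (hs : s ∈ degreeLT ℝ (n + 1))
    (h : ∀ g ∈ degreeLT ℝ n, unitIntegral (s * g) = 0) :
    unitIntegral ((X - X ^ 2) * derivative s ^ 2) = n * (n + 1) * unitIntegral (s ^ 2) := by
  -- The leading coefficient is multiplied by the eigenvalue $n(n+1)$, so the difference drops in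
  -- degree and is orthogonal to `s`.
  have hmem : -derivative ((X - X ^ 2) * derivative s) - (n * (n + 1) : ℝ) • s ∈ degreeLT ℝ n := by
    rw [mem_degreeLT_iff_coeff] at hs ⊢
    intro m hm
    rw [coeff_sub, coeff_legendre, hs (m + 1) (by omega), coeff_smul, smul_eq_mul]
    rcases hm.eq_or_lt with rfl | hm
    · ring
    · rw [hs m (by omega)]; ring
  have h1 := h _ hmem
  rw [mul_sub, map_sub, mul_smul_comm, map_smul, smul_eq_mul, ← pow_two, sub_eq_zero] at h1
  rw [← h1, pow_two (derivative s), ← mul_assoc, unitIntegral_weight_mul, mul_comm]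

/-- The weighted Bernstein inequality in `L²(0,1)`. -/
theorem unitIntegral_weight_sq_le (n : ℕ) : ∀ q ∈ degreeLT ℝ n,
    unitIntegral ((X - X ^ 2) * derivative q ^ 2) ≤ (n : ℝ) ^ 2 * unitIntegral (q ^ 2) := by
  induction n with
  | zero =>
    intro q hq
    have : q = 0 := by
      ext m; exact mem_degreeLT_iff_coeff.mp hq m (Nat.zero_le _)
    simp [this]
  | succ n ih =>
    intro q hq
    obtain ⟨r, hr, horth⟩ := exists_orthogonal_decomposition n q
    obtain ⟨s, rfl⟩ : ∃ s, q = r + s := ⟨q - r, by ring⟩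
    rw [add_sub_cancel_left] at horth
    have hs : s ∈ degreeLT ℝ (n + 1) := by
      have := Submodule.sub_mem _ hq (degreeLT_mono n.le_succ hr)
      rwa [add_sub_cancel_left] at this
    have h1 := ih r hr
    have h2 := unitIntegral_weight_sq_of_orthogonal hs horth
    have h3 := unitIntegral_sq_nonneg r
    have h4 := unitIntegral_sq_nonneg s
    -- The Legendre operator preserves the degree bound, so the splitting is orthogonal for the
    -- weighted form too.
    have h5 : unitIntegral ((X - X ^ 2) * derivative r * derivative s) = 0 := by
      rw [unitIntegral_weight_mul, mul_comm]
      exact horth _ (legendre_mem_degreeLT hr)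
    have h6 : (X - X ^ 2) * derivative (r + s) ^ 2 = (X - X ^ 2) * derivative r ^ 2
        + (X - X ^ 2) * derivative s ^ 2
        + (2 : ℝ) • ((X - X ^ 2) * derivative r * derivative s) := by
      rw [smul_eq_C_mul, C_ofNat, derivative_add]; ring
    rw [unitIntegral_sq_add (horth r hr), h6, map_add, map_add, map_smul, h5, h2]
    push_cast
    have hn : (0 : ℝ) ≤ n := n.cast_nonneg
    rw [smul_zero, add_zero]
    nlinarith [mul_nonneg hn h3, mul_nonneg hn h4]

theorem mem_degreeLT_succ_of_natDegree_le {p : ℕ} {q : ℝ[X]} (h : q.natDegree ≤ p) :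
    q ∈ degreeLT ℝ (p + 1) :=
  mem_degreeLT_iff_coeff.mpr fun _ hm => coeff_eq_zero_of_natDegree_lt (by omega)

theorem eval_sq_le_of_half_le {p : ℕ} {q : ℝ[X]} (hq : q.natDegree ≤ p) {x : ℝ}
    (hx : 1 / 2 ≤ x) (hx1 : x ≤ 1) :
    q.eval x ^ 2 ≤ 2 * ((p : ℝ) + 1) ^ 2 * ∫ t in (0 : ℝ)..1, q.eval t ^ 2 := by
  -- Stretching $[0,x]$ to $[0,1]$ turns `x` into an endpoint, at the cost of a factor $1/x\le2$.
  have hdeg : (q.comp (C x * X)).natDegree ≤ p := by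
    refine natDegree_comp_le.trans ((Nat.mul_le_mul hq (?_ : _ ≤ 1)).trans (by simp))
    exact (natDegree_C_mul_le _ _).trans natDegree_X_le
  have h1 := eval_one_sq_le _ _ (mem_degreeLT_succ_of_natDegree_le hdeg)
  simp only [eval_comp, eval_mul, eval_C, eval_X, mul_one, unitIntegral_apply, eval_pow] at h1
  have h2 : ∫ t in (0 : ℝ)..1, q.eval (x * t) ^ 2 = x⁻¹ * ∫ t in (0 : ℝ)..x, q.eval t ^ 2 := by
    rw [intervalIntegral.integral_comp_mul_left (fun t => q.eval t ^ 2) (by linarith : x ≠ 0)]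
    simp
  have h3 : ∫ t in (0 : ℝ)..x, q.eval t ^ 2 ≤ ∫ t in (0 : ℝ)..1, q.eval t ^ 2 :=
    intervalIntegral.integral_mono_interval le_rfl (by linarith) hx1
      (Eventually.of_forall fun t => sq_nonneg _)
      ((q.continuous.pow 2).intervalIntegrable _ _)
  have h4 : 0 ≤ ∫ t in (0 : ℝ)..x, q.eval t ^ 2 :=
    intervalIntegral.integral_nonneg (by linarith) fun t _ => sq_nonneg _
  have h5 : x⁻¹ ≤ 2 := by
    rw [inv_le_comm₀ (by linarith) two_pos]; linarith
  rw [h2] at h1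
  push_cast at h1
  calc _ ≤ _ := h1
    _ ≤ ((p : ℝ) + 1) ^ 2 * (2 * ∫ t in (0 : ℝ)..1, q.eval t ^ 2) := by gcongr
    _ = _ := by ring

/-- The `L^∞`-`L²` inverse estimate for polynomials on the unit interval. -/
theorem eval_sq_le {p : ℕ} {q : ℝ[X]} (hq : q.natDegree ≤ p) {x : ℝ}
    (hx : x ∈ Icc (0 : ℝ) 1) :
    q.eval x ^ 2 ≤ 2 * ((p : ℝ) + 1) ^ 2 * ∫ t in (0 : ℝ)..1, q.eval t ^ 2 := by
  rcases le_total (1 / 2) x with h | h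
  · exact eval_sq_le_of_half_le hq h hx.2
  · have hdeg : (q.comp (1 - X)).natDegree ≤ p := by
      refine natDegree_comp_le.trans ((Nat.mul_le_mul hq (?_ : _ ≤ 1)).trans (by simp))
      exact (natDegree_sub_le _ _).trans (by simp)
    have := eval_sq_le_of_half_le hdeg (x := 1 - x) (by linarith) (by linarith [hx.1])
    simp only [eval_comp, eval_sub, eval_one, eval_X, sub_sub_cancel] at this
    rwa [intervalIntegral.integral_comp_sub_left (fun t => q.eval t ^ 2), sub_self, sub_zero] at this

/-- A quarter of the mass of a squared polynomial at most lies in the boundary layers of width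
`1 / (16 (p + 1) ^ 2)`. -/
theorem integral_sq_le_integral_inner {p : ℕ} {q : ℝ[X]} (hq : q.natDegree ≤ p) {δ : ℝ}
    (hδ : δ = 1 / (16 * ((p : ℝ) + 1) ^ 2)) :
    3 / 4 * ∫ t in (0 : ℝ)..1, q.eval t ^ 2 ≤ ∫ t in δ..(1 - δ), q.eval t ^ 2 := by
  set M := ∫ t in (0 : ℝ)..1, q.eval t ^ 2
  have hp : (1 : ℝ) ≤ ((p : ℝ) + 1) ^ 2 := one_le_pow₀ (by simp)
  have hδ0 : 0 < δ := by rw [hδ]; positivity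
  have hδ1 : δ ≤ 1 / 16 := by
    rw [hδ]; apply one_div_le_one_div_of_le <;> linarith
  have hδ2 : ((p : ℝ) + 1) ^ 2 * δ = 1 / 16 := by rw [hδ]; field_simp
  have hint : ∀ a b, IntervalIntegrable (fun t => q.eval t ^ 2) volume a b := fun a b =>
    (q.continuous.pow 2).intervalIntegrable _ _
  have hsplit : M = (∫ t in (0 : ℝ)..δ, q.eval t ^ 2) + (∫ t in δ..(1 - δ), q.eval t ^ 2)
      + ∫ t in (1 - δ)..1, q.eval t ^ 2 := by
    rw [intervalIntegral.integral_add_adjacent_intervals (hint _ _) (hint _ _),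
      intervalIntegral.integral_add_adjacent_intervals (hint _ _) (hint _ _)]
  -- Width times the pointwise bound: $2(p+1)^2\delta=1/8$ for each of the two layers.
  have hlayer : ∀ a b : ℝ, 0 ≤ a → a ≤ b → b ≤ 1 → b - a = δ →
      ∫ t in a..b, q.eval t ^ 2 ≤ 1 / 8 * M := by
    intro a b ha hab hb hd
    calc ∫ t in a..b, q.eval t ^ 2 ≤ ∫ t in a..b, 2 * ((p : ℝ) + 1) ^ 2 * M :=
          intervalIntegral.integral_mono_on hab (hint _ _) intervalIntegrable_const
            fun t ht => eval_sq_le hq ⟨ha.trans ht.1, ht.2.trans hb⟩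
      _ = 2 * (((p : ℝ) + 1) ^ 2 * δ) * M := by
          rw [intervalIntegral.integral_const, hd, smul_eq_mul]; ring
      _ = 1 / 8 * M := by rw [hδ2]; ring
  have h1 := hlayer 0 δ le_rfl hδ0.le (by linarith) (by ring)
  have h2 := hlayer (1 - δ) 1 (by linarith) (by linarith) le_rfl (by ring)
  linarith

/-- The Markov inequality in `L²(0,1)`. -/
theorem integral_derivative_sq_le {p : ℕ} {q : ℝ[X]} (hq : q.natDegree ≤ p) :
    ∫ t in (0 : ℝ)..1, (derivative q).eval t ^ 2 ≤
      64 * ((p : ℝ) + 1) ^ 4 * ∫ t in (0 : ℝ)..1, q.eval t ^ 2 := by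
  obtain ⟨δ, hδ⟩ : ∃ δ : ℝ, δ = 1 / (16 * ((p : ℝ) + 1) ^ 2) := ⟨_, rfl⟩
  have hp : (1 : ℝ) ≤ ((p : ℝ) + 1) ^ 2 := one_le_pow₀ (by simp)
  have hδ0 : 0 < δ := by rw [hδ]; positivity
  have hδ1 : δ ≤ 1 / 16 := by
    rw [hδ]; apply one_div_le_one_div_of_le <;> linarith
  have hδ2 : ((p : ℝ) + 1) ^ 2 * δ = 1 / 16 := by rw [hδ]; field_simp
  -- Applied to the derivative: most of its mass lies where the weight $t-t^2$ is at least
  -- $\delta(1-\delta)\sim(p+1)^{-2}$, so the weighted Bernstein inequality yields the unweighted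
  -- one.
  have h1 := integral_sq_le_integral_inner
    (((natDegree_derivative_le q).trans (Nat.sub_le _ _)).trans hq) hδ
  have h2 := unitIntegral_weight_sq_le _ q (mem_degreeLT_succ_of_natDegree_le hq)
  simp only [unitIntegral_apply, eval_mul, eval_sub, eval_X, eval_pow] at h2
  have hcont : Continuous fun t : ℝ => (t - t ^ 2) * (derivative q).eval t ^ 2 := by
    have := (derivative q).continuous
    fun_prop
  have h3 : δ * (1 - δ) * ∫ t in δ..(1 - δ), (derivative q).eval t ^ 2 ≤
      ∫ t in (0 : ℝ)..1, (t - t ^ 2) * (derivative q).eval t ^ 2 := by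
    rw [← intervalIntegral.integral_const_mul]
    calc _ ≤ ∫ t in δ..(1 - δ), (t - t ^ 2) * (derivative q).eval t ^ 2 := by
          refine intervalIntegral.integral_mono_on (by linarith)
            (((derivative q).continuous.pow 2).const_mul _ |>.intervalIntegrable _ _)
            (hcont.intervalIntegrable _ _) fun t ht => ?_
          gcongr
          nlinarith [ht.1, ht.2]
      _ ≤ _ := by
          refine intervalIntegral.integral_mono_interval hδ0.le (by linarith) (by linarith) ?_
            (hcont.intervalIntegrable _ _)
          refine (ae_restrict_iff' measurableSet_Ioc).mpr (Eventually.of_forall fun t ht => ?_)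
          have : 0 ≤ t - t ^ 2 := by nlinarith [ht.1, ht.2]
          change 0 ≤ _
          positivity
  set D := ∫ t in (0 : ℝ)..1, (derivative q).eval t ^ 2
  set M := ∫ t in (0 : ℝ)..1, q.eval t ^ 2
  have hM : 0 ≤ M := intervalIntegral.integral_nonneg zero_le_one fun _ _ => sq_nonneg _
  have h4 : δ * (3 / 4 * (15 / 16) * D) ≤ ((p : ℝ) + 1) ^ 2 * M := by
    have hD : 0 ≤ D := intervalIntegral.integral_nonneg zero_le_one fun _ _ => sq_nonneg _
    push_cast at h2
    calc δ * (3 / 4 * (15 / 16) * D) = δ * (15 / 16) * (3 / 4 * D) := by ring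
      _ ≤ δ * (1 - δ) * (∫ t in δ..(1 - δ), (derivative q).eval t ^ 2) := by
          have : 15 / 16 ≤ 1 - δ := by linarith
          have : 0 ≤ δ * (1 - δ) := by positivity
          gcongr
      _ ≤ _ := h3.trans h2
  have h5 : ((p : ℝ) + 1) ^ 2 * (δ * (3 / 4 * (15 / 16) * D)) ≤
      ((p : ℝ) + 1) ^ 2 * (((p : ℝ) + 1) ^ 2 * M) := by gcongr
  rw [← mul_assoc, hδ2] at h5
  have : 0 ≤ ((p : ℝ) + 1) ^ 4 * M := by positivity
  nlinarith

end Univariate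

/-! ### Cutoff functions on the unit interval -/

theorem exists_abs_deriv_smoothTransition_le :
    ∃ C : ℝ, 0 < C ∧ ∀ x, |deriv Real.smoothTransition x| ≤ C := by
  have hc : Continuous (deriv Real.smoothTransition) :=
    Real.smoothTransition.contDiff (n := 1) |>.continuous_deriv le_rfl
  obtain ⟨C, hC⟩ := (isCompact_Icc (a := (0 : ℝ)) (b := 1)).exists_bound_of_continuousOn
    hc.continuousOn
  refine ⟨max C 1, by positivity, fun x => ?_⟩
  by_cases hx : x ∈ Icc (0 : ℝ) 1
  · exact (hC x hx).trans (le_max_left _ _)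
  · have h0 : deriv Real.smoothTransition x = 0 := by
      rw [mem_Icc, not_and_or, not_le, not_le] at hx
      rcases hx with hx | hx
      · have : Real.smoothTransition =ᶠ[𝓝 x] fun _ => 0 := by
          filter_upwards [Iio_mem_nhds hx] with y hy
          exact Real.smoothTransition.zero_of_nonpos (le_of_lt hy)
        rw [this.deriv_eq, deriv_const]
      · have : Real.smoothTransition =ᶠ[𝓝 x] fun _ => 1 := by
          filter_upwards [Ioi_mem_nhds hx] with y hy
          exact Real.smoothTransition.one_of_one_le (le_of_lt hy)
        rw [this.deriv_eq, deriv_const]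
    rw [h0, abs_zero]
    positivity

/-- Smooth cutoff functions of the unit interval that are compatible with polynomials of degree at
most `p`. -/
theorem exists_cutoff : ∃ C : ℝ, 0 < C ∧ ∀ p : ℕ, ∃ χ : ℝ → ℝ, ContDiff ℝ ∞ χ ∧
    (∃ ε > 0, ∀ x, x ∉ Icc ε (1 - ε) → χ x = 0) ∧ (∀ x, 0 ≤ χ x) ∧ (∀ x, χ x ≤ 1) ∧
    (∀ x, |deriv χ x| ≤ C * ((p : ℝ) + 1) ^ 2) ∧
    ∀ q : Polynomial ℝ, q.natDegree ≤ p →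
      3 / 4 * ∫ t in (0 : ℝ)..1, q.eval t ^ 2 ≤ ∫ t in (0 : ℝ)..1, χ t * q.eval t ^ 2 := by
  obtain ⟨K, hK, hKb⟩ := exists_abs_deriv_smoothTransition_le
  refine ⟨64 * K, by positivity, fun p => ?_⟩
  obtain ⟨δ, hδ⟩ : ∃ δ : ℝ, δ = 1 / (16 * ((p : ℝ) + 1) ^ 2) := ⟨_, rfl⟩
  have hp : (1 : ℝ) ≤ ((p : ℝ) + 1) ^ 2 := one_le_pow₀ (by simp)
  have hδ0 : 0 < δ := by rw [hδ]; positivity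
  have hδ1 : δ ≤ 1 / 16 := by
    rw [hδ]; apply one_div_le_one_div_of_le <;> linarith
  have hδ2 : 2 / δ = 32 * ((p : ℝ) + 1) ^ 2 := by rw [hδ]; field_simp; norm_num
  have hs : ContDiff ℝ ∞ Real.smoothTransition := Real.smoothTransition.contDiff (n := ⊤)
  -- Rises from 0 to 1 on $[\delta/2,\delta]$: the slope is of order $1/\delta\sim(p+1)^2$, and the
  -- support stays away from the endpoint. The product with the reflection treats both ends.
  let f : ℝ → ℝ := fun x => Real.smoothTransition (2 / δ * x - 1)
  have hf : ContDiff ℝ ∞ f := hs.comp (by fun_prop)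
  have hf0 : ∀ x, 0 ≤ f x := fun x => Real.smoothTransition.nonneg _
  have hf1 : ∀ x, f x ≤ 1 := fun x => Real.smoothTransition.le_one _
  have hfd : ∀ x, ∃ d, HasDerivAt f d x ∧ |d| ≤ 32 * K * ((p : ℝ) + 1) ^ 2 := by
    intro x
    refine ⟨_, HasDerivAt.comp x ((hs.differentiable (by simp)) _).hasDerivAt
      (((hasDerivAt_id x).const_mul (2 / δ)).sub_const 1), ?_⟩
    rw [mul_one, abs_mul, abs_of_pos (by positivity : 0 < 2 / δ)]
    calc _ ≤ K * (2 / δ) := by gcongr; exact hKb _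
      _ = _ := by rw [hδ2]; ring
  have hfz : ∀ x, x < δ / 2 → f x = 0 := by
    intro x hx
    refine Real.smoothTransition.zero_of_nonpos ?_
    have : 2 / δ * x ≤ 2 / δ * (δ / 2) := by gcongr
    have h2 : 2 / δ * (δ / 2) = 1 := by field_simp
    linarith
  have hfo : ∀ x, δ ≤ x → f x = 1 := by
    intro x hx
    refine Real.smoothTransition.one_of_one_le ?_
    have : 2 / δ * δ ≤ 2 / δ * x := by gcongr
    have h2 : 2 / δ * δ = 2 := by field_simp
    linarith
  have hχ : ContDiff ℝ ∞ fun x => f x * f (1 - x) := hf.mul (hf.comp (by fun_prop))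
  refine ⟨fun x => f x * f (1 - x), hχ, ⟨δ / 2, by positivity, fun x hx => ?_⟩,
    fun x => mul_nonneg (hf0 _) (hf0 _), fun x => mul_le_one₀ (hf1 _) (hf0 _) (hf1 _),
    fun x => ?_, fun q hq => ?_⟩
  · rw [mem_Icc, not_and_or, not_le, not_le] at hx
    rcases hx with hx | hx
    · simp [hfz x hx]
    · simp [hfz (1 - x) (by linarith)]
  · obtain ⟨d, hd, hdb⟩ := hfd x
    obtain ⟨e, he, heb⟩ := hfd (1 - x)
    have h := hd.mul (he.comp x ((hasDerivAt_id x).const_sub 1))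
    have h' : HasDerivAt (fun x => f x * f (1 - x)) _ x := h
    rw [h'.deriv]
    calc |d * f (1 - id x) + f x * (e * -1)| ≤ |d * f (1 - id x)| + |f x * (e * -1)| :=
          abs_add_le _ _
      _ = |d| * f (1 - x) + f x * |e| := by
          rw [abs_mul, abs_mul, abs_mul, abs_neg, abs_one, abs_of_nonneg (hf0 _),
            abs_of_nonneg (hf0 _), mul_one, id]
      _ ≤ 32 * K * ((p : ℝ) + 1) ^ 2 * 1 + 1 * (32 * K * ((p : ℝ) + 1) ^ 2) := by
          gcongr
          · exact hf0 _
          · exact hf1 _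
          · exact hf1 _
      _ = _ := by ring
  · refine (integral_sq_le_integral_inner hq hδ).trans ?_
    have hcont : Continuous fun t : ℝ => f t * f (1 - t) * q.eval t ^ 2 :=
      hχ.continuous.mul (q.continuous.pow 2)
    calc ∫ t in δ..(1 - δ), q.eval t ^ 2
        = ∫ t in δ..(1 - δ), f t * f (1 - t) * q.eval t ^ 2 := by
          refine intervalIntegral.integral_congr fun t ht => ?_
          rw [uIcc_of_le (by linarith)] at ht
          rw [hfo t ht.1, hfo (1 - t) (by linarith [ht.2])]
          ring
      _ ≤ _ := intervalIntegral.integral_mono_interval hδ0.le (by linarith) (by linarith)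
          (Eventually.of_forall fun t => mul_nonneg (mul_nonneg (hf0 _) (hf0 _)) (sq_nonneg _))
          (hcont.intervalIntegrable _ _)

/-- By the product rule, one term is controlled by the slope of the cutoff and the other by the
Markov inequality; both cost $(p+1)^4$, so the cutoff does not worsen the order. -/
theorem integral_deriv_cutoff_mul_sq_le {p : ℕ} {C : ℝ} {χ : ℝ → ℝ}
    (hχ : ContDiff ℝ ∞ χ) (h0 : ∀ x, 0 ≤ χ x) (h1 : ∀ x, χ x ≤ 1)
    (hd : ∀ x, |deriv χ x| ≤ C * ((p : ℝ) + 1) ^ 2)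
    {q : Polynomial ℝ} (hq : q.natDegree ≤ p) :
    ∫ t in (0 : ℝ)..1, deriv (fun x => χ x * q.eval x) t ^ 2 ≤
      (2 * C ^ 2 + 128) * ((p : ℝ) + 1) ^ 4 * ∫ t in (0 : ℝ)..1, q.eval t ^ 2 := by
  have hder : ∀ t, deriv (fun x => χ x * q.eval x) t =
      deriv χ t * q.eval t + χ t * q.derivative.eval t := fun t =>
    (((hχ.differentiable (by simp)) t).hasDerivAt.mul (q.hasDerivAt t)).deriv
  have hcd : Continuous (deriv χ) := hχ.continuous_deriv (by simp)
  have hcont := hχ.continuous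
  have hqc := q.continuous
  have hqd := q.derivative.continuous
  have key : ∀ t, deriv (fun x => χ x * q.eval x) t ^ 2 ≤
      2 * C ^ 2 * ((p : ℝ) + 1) ^ 4 * q.eval t ^ 2 + 2 * q.derivative.eval t ^ 2 := by
    intro t
    rw [hder]
    have e1 : deriv χ t ^ 2 ≤ (C * ((p : ℝ) + 1) ^ 2) ^ 2 := by
      rw [← sq_abs]; have := hd t; gcongr
    have e2 : χ t ^ 2 ≤ 1 := pow_le_one₀ (h0 t) (h1 t)
    calc _ ≤ 2 * (deriv χ t ^ 2 * q.eval t ^ 2) + 2 * (χ t ^ 2 * q.derivative.eval t ^ 2) := by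
          nlinarith [sq_nonneg (deriv χ t * q.eval t - χ t * q.derivative.eval t)]
      _ ≤ 2 * ((C * ((p : ℝ) + 1) ^ 2) ^ 2 * q.eval t ^ 2)
          + 2 * (1 * q.derivative.eval t ^ 2) := by gcongr
      _ = _ := by ring
  calc _ ≤ ∫ t in (0 : ℝ)..1, (2 * C ^ 2 * ((p : ℝ) + 1) ^ 4 * q.eval t ^ 2
        + 2 * q.derivative.eval t ^ 2) := by
        refine intervalIntegral.integral_mono_on zero_le_one
          (Continuous.intervalIntegrable ?_ _ _) (Continuous.intervalIntegrable ?_ _ _)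
          fun t _ => key t
        · simp only [hder]; fun_prop
        · fun_prop
    _ = 2 * C ^ 2 * ((p : ℝ) + 1) ^ 4 * (∫ t in (0 : ℝ)..1, q.eval t ^ 2)
        + 2 * ∫ t in (0 : ℝ)..1, q.derivative.eval t ^ 2 := by
        rw [intervalIntegral.integral_add, intervalIntegral.integral_const_mul,
          intervalIntegral.integral_const_mul] <;>
        exact Continuous.intervalIntegrable (by fun_prop) _ _
    _ ≤ 2 * C ^ 2 * ((p : ℝ) + 1) ^ 4 * (∫ t in (0 : ℝ)..1, q.eval t ^ 2)
        + 2 * (64 * ((p : ℝ) + 1) ^ 4 * ∫ t in (0 : ℝ)..1, q.eval t ^ 2) := by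
        gcongr
        exact integral_derivative_sq_le hq
    _ = _ := by ring

/-! ### Slicewise integration over the unit square -/

/-- The closed unit square. -/
abbrev unitSquare : Set (ℝ × ℝ) := Icc 0 1 ×ˢ Icc 0 1

theorem integrableOn_unitSquare {f : ℝ × ℝ → ℝ} (hf : Continuous f) :
    IntegrableOn f unitSquare :=
  hf.continuousOn.integrableOn_compact (isCompact_Icc.prod isCompact_Icc)

theorem integral_unitSquare_right {f : ℝ × ℝ → ℝ} (hf : Continuous f) :
    ∫ z in unitSquare, f z = ∫ s in Icc (0 : ℝ) 1, ∫ t in (0 : ℝ)..1, f (s, t) := by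
  have h := setIntegral_prod f (μ := volume) (ν := volume) (integrableOn_unitSquare hf)
  rw [Measure.volume_eq_prod, h]
  simp only [intervalIntegral.integral_of_le zero_le_one, integral_Icc_eq_integral_Ioc]

theorem integral_unitSquare_left {f : ℝ × ℝ → ℝ} (hf : Continuous f) :
    ∫ z in unitSquare, f z = ∫ t in Icc (0 : ℝ) 1, ∫ s in (0 : ℝ)..1, f (s, t) := by
  have hf' : Continuous fun z : ℝ × ℝ => f z.swap := hf.comp continuous_swap
  have h := integral_unitSquare_right hf'
  simp only [Prod.swap_prod_mk] at h
  rw [← h]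
  have := setIntegral_prod_swap (μ := (volume : Measure ℝ)) (ν := (volume : Measure ℝ))
    (Icc (0 : ℝ) 1) (Icc (0 : ℝ) 1) f
  rw [Measure.volume_eq_prod, this]

theorem integrableOn_intervalIntegral_right {f : ℝ × ℝ → ℝ} (hf : Continuous f) :
    IntegrableOn (fun s => ∫ t in (0 : ℝ)..1, f (s, t)) (Icc (0 : ℝ) 1) := by
  have : Continuous fun s => ∫ t in (0 : ℝ)..1, f (s, t) :=
    intervalIntegral.continuous_parametric_intervalIntegral_of_continuous' (by exact hf) _ _
  exact this.continuousOn.integrableOn_compact isCompact_Icc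

theorem integral_unitSquare_mono_right {f g : ℝ × ℝ → ℝ} (hf : Continuous f) (hg : Continuous g)
    (h : ∀ s, ∫ t in (0 : ℝ)..1, f (s, t) ≤ ∫ t in (0 : ℝ)..1, g (s, t)) :
    ∫ z in unitSquare, f z ≤ ∫ z in unitSquare, g z := by
  rw [integral_unitSquare_right hf, integral_unitSquare_right hg]
  exact integral_mono (integrableOn_intervalIntegral_right hf)
    (integrableOn_intervalIntegral_right hg) h

theorem integral_unitSquare_mono_left {f g : ℝ × ℝ → ℝ} (hf : Continuous f) (hg : Continuous g)
    (h : ∀ t, ∫ s in (0 : ℝ)..1, f (s, t) ≤ ∫ s in (0 : ℝ)..1, g (s, t)) :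
    ∫ z in unitSquare, f z ≤ ∫ z in unitSquare, g z := by
  rw [integral_unitSquare_left hf, integral_unitSquare_left hg]
  exact integral_mono (integrableOn_intervalIntegral_right (hf.comp continuous_swap))
    (integrableOn_intervalIntegral_right (hg.comp continuous_swap)) h

/-! ### The inverse estimate on a parallelogram -/

/-- By uniqueness of Haar measure. The factor `k` is the Jacobian; its value is irrelevant, since it
multiplies both sides of every inequality to be transported. -/
theorem exists_setIntegral_parallelogram_eq (A : Plane) (M : (ℝ × ℝ) ≃L[ℝ] Plane) :
    ∃ k : ℝ, 0 ≤ k ∧ ∀ f : Plane → ℝ,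
      ∫ x in (fun z => A + M z) '' unitSquare, f x = k * ∫ z in unitSquare, f (A + M z) := by
  have hH : ((volume : Measure (ℝ × ℝ)).map M).IsAddHaarMeasure :=
    M.isAddHaarMeasure_map volume
  have hvol := Measure.isAddLeftInvariant_eq_smul (volume : Measure Plane)
    ((volume : Measure (ℝ × ℝ)).map M)
  generalize (volume : Measure Plane).addHaarScalarFactor
    ((volume : Measure (ℝ × ℝ)).map M) = k at hvol
  refine ⟨(k : ℝ), NNReal.coe_nonneg _, fun f => ?_⟩
  have h1 := (measurePreserving_add_left (volume : Measure Plane) A).setIntegral_image_emb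
    (measurableEmbedding_addLeft A) f (M '' unitSquare)
  rw [image_image] at h1
  have hM : MeasurableEmbedding M := M.toHomeomorph.measurableEmbedding
  rw [h1, hvol, Measure.restrict_smul, integral_smul_nnreal_measure, hM.setIntegral_map,
    preimage_image_eq _ M.injective]
  rfl

theorem contDiff_polyFun (q : MvPolynomial (Fin 2) ℝ) : ContDiff ℝ ∞ (polyFun q) := by
  induction q using MvPolynomial.induction_on with
  | C a =>
    have : polyFun (MvPolynomial.C a) = fun _ => a := by ext x; simp [polyFun]
    rw [this]; exact contDiff_const
  | add f g hf hg =>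
    have : polyFun (f + g) = fun x => polyFun f x + polyFun g x := by ext x; simp [polyFun]
    rw [this]; exact hf.add hg
  | mul_X f i hf =>
    have : polyFun (f * MvPolynomial.X i) = fun x => polyFun f x * x i := by
      ext x; simp [polyFun]
    rw [this]; exact hf.mul (by fun_prop)

/-- The restriction of a polynomial to a line. -/
theorem exists_polynomial_line {p : ℕ} {q : MvPolynomial (Fin 2) ℝ} (hq : q.totalDegree ≤ p)
    (x d : Plane) : ∃ r : Polynomial ℝ, r.natDegree ≤ p ∧
      ∀ s : ℝ, polyFun q (x + s • d) = r.eval s := by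
  refine ⟨MvPolynomial.aeval (fun i => Polynomial.C (x i) + Polynomial.C (d i) * Polynomial.X) q,
    ?_, fun s => ?_⟩
  · simpa using MvPolynomial.aeval_natDegree_le q hq _ (n := 1) fun i => by compute_degree
  · rw [polyFun, ← Polynomial.coe_aeval_eq_eval, MvPolynomial.comp_aeval_apply,
      MvPolynomial.aeval_eq_eval]
    congr 2
    funext i
    simp only [PiLp.add_apply, PiLp.smul_apply, smul_eq_mul, map_add, map_mul, Polynomial.aeval_C,
      Polynomial.aeval_X, Algebra.algebraMap_self, RingHom.id_apply]
    ring

/-- On a parallelogram, the product of a polynomial and a smooth cutoff function is a test function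
that realizes the inverse estimate. -/
theorem exists_testFunction_parallelogram : ∃ K : ℝ, 0 < K ∧
    ∀ (p : ℕ) (q : MvPolynomial (Fin 2) ℝ), q.totalDegree ≤ p →
    ∀ (A : Plane) (M : (ℝ × ℝ) ≃L[ℝ] Plane) (ρ : ℝ), 0 < ρ →
    (∀ g : Plane, ρ * ‖g‖ ≤ |inner ℝ g (M (1, 0))| + |inner ℝ g (M (0, 1))|) →
    ∃ Φ : Plane → ℝ, ContDiff ℝ ∞ Φ ∧ HasCompactSupport Φ ∧
      tsupport Φ ⊆ (fun z => A + M z) '' (Ioo 0 1 ×ˢ Ioo 0 1) ∧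
      1 / 2 * ∫ x in (fun z => A + M z) '' unitSquare, polyFun q x ^ 2 ≤
        ∫ x in (fun z => A + M z) '' unitSquare, polyFun q x * Φ x ∧
      ∫ x in (fun z => A + M z) '' unitSquare, ‖∇ Φ x‖ ^ 2 ≤ K * ((p : ℝ) + 1) ^ 4 / ρ ^ 2 *
        ∫ x in (fun z => A + M z) '' unitSquare, polyFun q x ^ 2 := by
  obtain ⟨C, hC, hcut⟩ := exists_cutoff
  refine ⟨4 * (2 * C ^ 2 + 128), by positivity, fun p q hq A M ρ hρ hM => ?_⟩
  obtain ⟨χ, hχ, ⟨ε, hε, hχε⟩, h0, h1, hd, hmass⟩ := hcut p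
  obtain ⟨k, hk, hint⟩ := exists_setIntegral_parallelogram_eq A M
  have hqc := contDiff_polyFun q
  let g : ℝ × ℝ → ℝ := fun z => polyFun q (A + M z)
  let Φ : Plane → ℝ := fun x =>
    χ (M.symm (x - A)).1 * χ (M.symm (x - A)).2 * polyFun q x
  have hΦ : ContDiff ℝ ∞ Φ := by
    refine ContDiff.mul (ContDiff.mul (hχ.comp ?_) (hχ.comp ?_)) hqc <;> fun_prop
  have hΦM : ∀ z, Φ (A + M z) = χ z.1 * χ z.2 * g z := by
    intro z; simp [Φ, g]
  have hMz : ∀ s t : ℝ, M (s, t) = s • M (1, 0) + t • M (0, 1) := by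
    intro s t
    rw [← map_smul, ← map_smul, ← map_add]
    simp
  have hχc := hχ.continuous
  have hgc : Continuous g := hqc.continuous.comp (by fun_prop)
  have hslice1 : ∀ t, ∃ r : Polynomial ℝ, r.natDegree ≤ p ∧ ∀ s, g (s, t) = r.eval s := by
    intro t
    obtain ⟨r, hr, hrs⟩ := exists_polynomial_line hq (A + t • M (0, 1)) (M (1, 0))
    refine ⟨r, hr, fun s => ?_⟩
    rw [← hrs, add_assoc, add_comm (t • _), ← hMz]
  have hslice2 : ∀ s, ∃ r : Polynomial ℝ, r.natDegree ≤ p ∧ ∀ t, g (s, t) = r.eval t := by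
    intro s
    obtain ⟨r, hr, hrs⟩ := exists_polynomial_line hq (A + s • M (1, 0)) (M (0, 1))
    refine ⟨r, hr, fun t => ?_⟩
    rw [← hrs, add_assoc, ← hMz]
  let P : Set Plane := (fun z => A + M z) '' (Icc ε (1 - ε) ×ˢ Icc ε (1 - ε))
  have hPc : IsCompact P := (isCompact_Icc.prod isCompact_Icc).image (by fun_prop)
  have hΦP : ∀ x, x ∉ P → Φ x = 0 := by
    intro x hx
    by_contra hne
    apply hx
    refine ⟨M.symm (x - A), ⟨?_, ?_⟩, by simp⟩ <;> by_contra hz <;> apply hne <;>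
      simp only [Φ, hχε _ hz, zero_mul, mul_zero]
  have hsupp : tsupport Φ ⊆ P :=
    closure_minimal (fun x hx => by_contra fun hxP => hx (hΦP x hxP)) hPc.isClosed
  refine ⟨Φ, hΦ, HasCompactSupport.intro hPc hΦP, hsupp.trans (image_mono ?_), ?_, ?_⟩
  · exact prod_mono (Icc_subset_Ioo hε (by linarith)) (Icc_subset_Ioo hε (by linarith))
  · rw [hint, hint, mul_left_comm]
    refine mul_le_mul_of_nonneg_left ?_ hk
    -- One cutoff is inserted per coordinate direction, each keeping three quarters of the mass:
    -- $9/16\ge1/2$.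
    have e1 : 3 / 4 * ∫ z in unitSquare, g z ^ 2 ≤ ∫ z in unitSquare, χ z.2 * g z ^ 2 := by
      rw [← integral_const_mul]
      refine integral_unitSquare_mono_right (by fun_prop) (by fun_prop) fun s => ?_
      obtain ⟨r, hr, hrs⟩ := hslice2 s
      simp only [hrs, intervalIntegral.integral_const_mul]
      exact hmass r hr
    have e2 : 3 / 4 * ∫ z in unitSquare, χ z.2 * g z ^ 2 ≤
        ∫ z in unitSquare, χ z.1 * (χ z.2 * g z ^ 2) := by
      rw [← integral_const_mul]
      refine integral_unitSquare_mono_left (by fun_prop) (by fun_prop) fun t => ?_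
      obtain ⟨r, hr, hrs⟩ := hslice1 t
      have := mul_le_mul_of_nonneg_left (hmass r hr) (h0 t)
      simp only [hrs]
      simp only [mul_left_comm (χ _) (χ t), intervalIntegral.integral_const_mul]
      linarith
    have e3 : ∀ z, polyFun q (A + M z) * Φ (A + M z) = χ z.1 * (χ z.2 * g z ^ 2) := by
      intro z; rw [hΦM]; simp only [g]; ring
    simp only [e3]
    have e4 : 0 ≤ ∫ z in unitSquare, g z ^ 2 := integral_nonneg fun z => sq_nonneg _
    change 1 / 2 * ∫ z in unitSquare, g z ^ 2 ≤ _
    linarith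
  · rw [hint, hint, mul_left_comm]
    refine mul_le_mul_of_nonneg_left ?_ hk
    have hΦd : Continuous (fderiv ℝ Φ) := hΦ.continuous_fderiv (by simp)
    let a : ℝ × ℝ → ℝ := fun z => fderiv ℝ Φ (A + M z) (M (1, 0))
    let b : ℝ × ℝ → ℝ := fun z => fderiv ℝ Φ (A + M z) (M (0, 1))
    have hac : Continuous a := by fun_prop
    have hbc : Continuous b := by fun_prop
    have hline : ∀ x d : Plane, ∀ s : ℝ,
        deriv (fun s : ℝ => Φ (x + s • d)) s = fderiv ℝ Φ (x + s • d) d := by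
      intro x d s
      have h2 : HasDerivAt (fun s : ℝ => x + s • d) d s := by
        simpa using ((hasDerivAt_id s).smul_const d).const_add x
      exact (((hΦ.differentiable (by simp)) _).hasFDerivAt.comp_hasDerivAt s h2).deriv
    have ha : ∀ s t, a (s, t) = deriv (fun s => χ s * χ t * g (s, t)) s := by
      intro s t
      have := hline (A + t • M (0, 1)) (M (1, 0)) s
      have e : ∀ s : ℝ, A + t • M (0, 1) + s • M (1, 0) = A + M (s, t) := by
        intro s; rw [hMz s t]; abel
      simp only [e, hΦM] at this
      exact this.symm
    have hb : ∀ s t, b (s, t) = deriv (fun t => χ s * χ t * g (s, t)) t := by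
      intro s t
      have := hline (A + s • M (1, 0)) (M (0, 1)) t
      have e : ∀ t : ℝ, A + s • M (1, 0) + t • M (0, 1) = A + M (s, t) := by
        intro t; rw [hMz s t]; abel
      simp only [e, hΦM] at this
      exact this.symm
    set L : ℝ := (2 * C ^ 2 + 128) * ((p : ℝ) + 1) ^ 4 with hL
    have hL0 : 0 ≤ L := by positivity
    -- The constant `c` stands for the cutoff in the other variable, frozen along the slice.
    have hone : ∀ (c : ℝ) (r : Polynomial ℝ), 0 ≤ c → c ≤ 1 → r.natDegree ≤ p →
        ∫ t in (0 : ℝ)..1, deriv (fun x => χ x * (c * r.eval x)) t ^ 2 ≤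
          ∫ t in (0 : ℝ)..1, L * r.eval t ^ 2 := by
      intro c r hc0 hc1 hr
      have h3 := integral_deriv_cutoff_mul_sq_le hχ h0 h1 hd (q := Polynomial.C c * r)
        ((Polynomial.natDegree_C_mul_le _ _).trans hr)
      simp only [Polynomial.eval_mul, Polynomial.eval_C] at h3
      refine h3.trans ?_
      rw [← intervalIntegral.integral_const_mul]
      have hrc := r.continuous
      refine intervalIntegral.integral_mono_on zero_le_one
        (Continuous.intervalIntegrable (by fun_prop) _ _)
        (Continuous.intervalIntegrable (by fun_prop) _ _) fun t _ => ?_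
      rw [mul_pow]
      exact mul_le_mul_of_nonneg_left
        (mul_le_of_le_one_left (sq_nonneg _) (pow_le_one₀ hc0 hc1)) hL0
    have ea : ∫ z in unitSquare, a z ^ 2 ≤ ∫ z in unitSquare, L * g z ^ 2 := by
      refine integral_unitSquare_mono_left (by fun_prop) (by fun_prop) fun t => ?_
      obtain ⟨r, hr, hrs⟩ := hslice1 t
      simp only [ha, hrs, mul_assoc]
      exact hone _ r (h0 t) (h1 t) hr
    have eb : ∫ z in unitSquare, b z ^ 2 ≤ ∫ z in unitSquare, L * g z ^ 2 := by
      refine integral_unitSquare_mono_right (by fun_prop) (by fun_prop) fun s => ?_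
      obtain ⟨r, hr, hrs⟩ := hslice2 s
      simp only [hb, hrs, mul_assoc, mul_left_comm (χ s)]
      exact hone _ r (h0 s) (h1 s) hr
    -- The hypothesis `hM` recovers the full gradient from the derivatives `a` and `b` along the two
    -- sides.
    have hgrad : ∀ z, ‖∇ Φ (A + M z)‖ ^ 2 ≤ 2 / ρ ^ 2 * (a z ^ 2 + b z ^ 2) := by
      intro z
      have h3 := hM (∇ Φ (A + M z))
      rw [inner_gradient_left, inner_gradient_left] at h3
      change ρ * _ ≤ |a z| + |b z| at h3
      have h4 : (ρ * ‖∇ Φ (A + M z)‖) ^ 2 ≤ (|a z| + |b z|) ^ 2 := by gcongr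
      have h5 : (|a z| + |b z|) ^ 2 ≤ 2 * (a z ^ 2 + b z ^ 2) := by
        rw [← sq_abs (a z), ← sq_abs (b z)]
        nlinarith [sq_nonneg (|a z| - |b z|)]
      rw [div_mul_eq_mul_div, le_div_iff₀ (by positivity)]
      nlinarith
    calc ∫ z in unitSquare, ‖∇ Φ (A + M z)‖ ^ 2
        ≤ ∫ z in unitSquare, 2 / ρ ^ 2 * (a z ^ 2 + b z ^ 2) :=
          integral_mono_of_nonneg (Eventually.of_forall fun z => sq_nonneg _)
            (integrableOn_unitSquare (by fun_prop)) (Eventually.of_forall hgrad)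
      _ = 2 / ρ ^ 2 * ((∫ z in unitSquare, a z ^ 2) + ∫ z in unitSquare, b z ^ 2) := by
          rw [integral_const_mul, integral_add (integrableOn_unitSquare (by fun_prop))
            (integrableOn_unitSquare (by fun_prop))]
      _ ≤ 2 / ρ ^ 2 * (L * (∫ z in unitSquare, g z ^ 2) + L * ∫ z in unitSquare, g z ^ 2) := by
          rw [← integral_const_mul]
          gcongr
      _ = _ := by rw [hL]; simp only [g]; ring

/-! ### Test functions and the dual norm -/

section TestFunctions

variable {E : Set Plane} {Φ : Plane → ℝ}

theorem IsTestFunction.continuous_gradient (h : IsTestFunction E Φ) : Continuous (∇ Φ) :=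
  (InnerProductSpace.toDual ℝ Plane).symm.continuous.comp (h.1.continuous_fderiv (by simp))

theorem IsTestFunction.gradient_eq_zero {x : Plane} (hx : x ∉ tsupport Φ) : ∇ Φ x = 0 := by
  have : fderiv ℝ Φ x = 0 := by
    by_contra hne
    exact hx (support_fderiv_subset ℝ hne)
  rw [gradient, this, map_zero]

theorem IsTestFunction.hasCompactSupport_gradient (h : IsTestFunction E Φ) :
    HasCompactSupport (∇ Φ) :=
  HasCompactSupport.intro h.2.1 fun _ hx => gradient_eq_zero hx

theorem IsTestFunction.memH1 (h : IsTestFunction E Φ) : MemH1 E Φ (∇ Φ) where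
  memLp := (h.1.continuous.memLp_of_hasCompactSupport h.2.1).restrict E
  memLp_grad := (h.continuous_gradient.memLp_of_hasCompactSupport
    h.hasCompactSupport_gradient).restrict E
  weak_grad φ hφ := by
    have hΦc := h.1.continuous
    have hφc := hφ.1.continuous
    have hΦg := h.continuous_gradient
    have hφg := hφ.continuous_gradient
    -- Both supports lie in `E`, so the integrals extend to the whole plane and integration by parts
    -- has no boundary term.
    rw [setIntegral_eq_integral_of_forall_compl_eq_zero fun x hx => by
        rw [gradient_eq_zero fun hx' => hx (hφ.2.2 hx'), smul_zero],
      setIntegral_eq_integral_of_forall_compl_eq_zero fun x hx => by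
        rw [gradient_eq_zero fun hx' => hx (h.2.2 hx'), smul_zero]]
    have i1 : Integrable fun x => Φ x • ∇ φ x :=
      (hΦc.smul hφg).integrable_of_hasCompactSupport h.2.1.smul_right
    have i2 : Integrable fun x => φ x • ∇ Φ x :=
      (hφc.smul hΦg).integrable_of_hasCompactSupport hφ.2.1.smul_right
    refine ext_inner_left ℝ fun v => ?_
    rw [inner_neg_right, ← integral_inner i1, ← integral_inner i2]
    have e : ∀ (f g : Plane → ℝ) (x : Plane),
        inner ℝ v (f x • ∇ g x) = f x * fderiv ℝ g x v := by
      intro f g x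
      rw [inner_smul_right, real_inner_comm, inner_gradient_left]
    simp only [e]
    have j1 := i1.const_inner (𝕜 := ℝ) v
    have j2 := i2.const_inner (𝕜 := ℝ) v
    simp only [e] at j1 j2
    rw [integral_mul_fderiv_eq_neg_fderiv_mul_of_integrable _ j1
      ((hΦc.mul hφc).integrable_of_hasCompactSupport h.2.1.mul_right)
      (fun x _ => h.1.differentiable (by simp) x) fun x _ => hφ.1.differentiable (by simp) x]
    · simp only [mul_comm]
    · simpa only [mul_comm] using j2

theorem IsTestFunction.memH10 (h : IsTestFunction E Φ) : MemH10 E Φ (∇ Φ) where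
  memH1 := h.memH1
  approx := ⟨fun _ => Φ, fun _ => h, by simp, by simp⟩

theorem eLpNorm_gradient_sq (h : IsTestFunction E Φ) :
    eLpNorm (∇ Φ) 2 (volume.restrict E) = ENNReal.ofReal √(∫ x in E, ‖∇ Φ x‖ ^ 2) := by
  rw [h.memH1.memLp_grad.eLpNorm_eq_integral_rpow_norm (by simp) (by simp), Real.sqrt_eq_rpow]
  simp

/-- A test function bounds the dual norm from below. -/
theorem IsTestFunction.le_negNorm (h : IsTestFunction E Φ) {f : Plane → ℝ} {a L : ℝ} (hL : 0 < L)
    (ha : 0 ≤ a) (hf : 1 / 2 * a ≤ ∫ x in E, f x * Φ x)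
    (hg : ∫ x in E, ‖∇ Φ x‖ ^ 2 ≤ L ^ 2 * a) :
    ENNReal.ofReal a ≤ (ENNReal.ofReal (2 * L) * negNorm E f) ^ 2 := by
  -- For `a = 0` the function may vanish, and then it is not admissible in the supremum.
  rcases ha.eq_or_lt with rfl | ha
  · simp
  have hne : ¬ Φ =ᵐ[volume.restrict E] 0 := by
    intro h0
    have : ∫ x in E, f x * Φ x = 0 := by
      rw [integral_congr_ae (g := fun _ => 0), integral_zero]
      filter_upwards [h0] with x hx
      simp [hx]
    linarith
  have h1 : ENNReal.ofReal (∫ x in E, f x * Φ x) / eLpNorm (∇ Φ) 2 (volume.restrict E) ≤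
      negNorm E f := by
    unfold negNorm
    exact le_iSup₂_of_le Φ (∇ Φ) (le_iSup₂_of_le h.memH10 hne le_rfl)
  have hsa : 0 < √a := Real.sqrt_pos.mpr ha
  have h2 : eLpNorm (∇ Φ) 2 (volume.restrict E) ≤ ENNReal.ofReal (L * √a) := by
    rw [eLpNorm_gradient_sq h]
    refine ENNReal.ofReal_le_ofReal ((Real.sqrt_le_sqrt hg).trans ?_)
    rw [Real.sqrt_mul (by positivity), Real.sqrt_sq hL.le]
  have h3 : ENNReal.ofReal (√a / (2 * L)) ≤ negNorm E f := by
    refine le_trans ?_ h1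
    -- The quotient for `Φ` is at least $(a/2)/(L\sqrt a)$.
    calc ENNReal.ofReal (√a / (2 * L)) = ENNReal.ofReal (1 / 2 * a / (L * √a)) := by
          congr 1
          rw [div_eq_div_iff (by positivity) (by positivity)]
          nlinarith [Real.sq_sqrt ha.le]
      _ = ENNReal.ofReal (1 / 2 * a) / ENNReal.ofReal (L * √a) :=
          ENNReal.ofReal_div_of_pos (by positivity)
      _ ≤ _ := ENNReal.div_le_div (ENNReal.ofReal_le_ofReal hf) h2
  calc ENNReal.ofReal a = (ENNReal.ofReal (2 * L) * ENNReal.ofReal (√a / (2 * L))) ^ 2 := by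
        rw [← ENNReal.ofReal_mul (by positivity), ← ENNReal.ofReal_pow (by positivity)]
        congr 1
        rw [mul_div_cancel₀ _ (by positivity), Real.sq_sqrt ha.le]
    _ ≤ _ := by gcongr

end TestFunctions

/-- The inverse estimate, with the `L²` norm taken over a parallelogram. -/
theorem exists_lintegral_parallelogram_le_negNorm : ∃ K : ℝ, 0 < K ∧
    ∀ (p : ℕ) (q : MvPolynomial (Fin 2) ℝ), q.totalDegree ≤ p →
    ∀ (A : Plane) (M : (ℝ × ℝ) ≃L[ℝ] Plane) (ρ : ℝ), 0 < ρ →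
    (∀ g : Plane, ρ * ‖g‖ ≤ |inner ℝ g (M (1, 0))| + |inner ℝ g (M (0, 1))|) →
    ∀ E : Set Plane, (fun z => A + M z) '' (Ioo 0 1 ×ˢ Ioo 0 1) ⊆ E →
    ∫⁻ x in (fun z => A + M z) '' unitSquare, ‖polyFun q x‖ₑ ^ 2 ≤
      (ENNReal.ofReal (K * ((p : ℝ) + 1) ^ 2 / ρ) * negNorm E (polyFun q)) ^ 2 := by
  obtain ⟨K, hK, H⟩ := exists_testFunction_parallelogram
  refine ⟨2 * √K, by positivity, fun p q hq A M ρ hρ hM E hE => ?_⟩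
  obtain ⟨Φ, hΦ, hcs, hsupp, hmass, hgrad⟩ := H p q hq A M ρ hρ hM
  set P := (fun z => A + M z) '' unitSquare
  have hPc : IsCompact P := (isCompact_Icc.prod isCompact_Icc).image (by fun_prop)
  have htest : IsTestFunction E Φ := ⟨hΦ, hcs, hsupp.trans hE⟩
  have hsP : tsupport Φ ⊆ P :=
    hsupp.trans (image_mono (prod_mono Ioo_subset_Icc_self Ioo_subset_Icc_self))
  have hset : ∀ f : Plane → ℝ, (∀ x, x ∉ tsupport Φ → f x = 0) →
      ∫ x in P, f x = ∫ x in E, f x := fun f hf => by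
    rw [setIntegral_eq_integral_of_forall_compl_eq_zero fun x hx => hf x fun h => hx (hsP h),
      setIntegral_eq_integral_of_forall_compl_eq_zero fun x hx => hf x fun h => hx (htest.2.2 h)]
  rw [hset (fun x => polyFun q x * Φ x) fun x hx => by
    rw [image_eq_zero_of_notMem_tsupport hx, mul_zero]] at hmass
  rw [hset (fun x => ‖∇ Φ x‖ ^ 2) fun x hx => by
    rw [IsTestFunction.gradient_eq_zero hx, norm_zero]; simp] at hgrad
  have hqc := (contDiff_polyFun q).continuous
  have hL : ∫⁻ x in P, ‖polyFun q x‖ₑ ^ 2 = ENNReal.ofReal (∫ x in P, polyFun q x ^ 2) := by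
    rw [ofReal_integral_eq_lintegral_ofReal (f := fun x => polyFun q x ^ 2)
      ((hqc.pow 2).continuousOn.integrableOn_compact hPc)
      (Eventually.of_forall fun x => sq_nonneg _)]
    refine lintegral_congr fun x => ?_
    rw [← ofReal_norm, ← ENNReal.ofReal_pow (norm_nonneg _), Real.norm_eq_abs,
      sq_abs]
  rw [hL]
  have := htest.le_negNorm (L := √K * ((p : ℝ) + 1) ^ 2 / ρ) (by positivity)
    (integral_nonneg fun x => sq_nonneg _) hmass (hgrad.trans_eq ?_)
  · convert this using 4
    ring
  · congr 1
    rw [div_pow, mul_pow, Real.sq_sqrt hK.le]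
    ring

/-! ### Triangles and their corner parallelograms -/

theorem eq_or_eq_add_one_or_eq_add_two (i m : Fin 3) : m = i ∨ m = i + 1 ∨ m = i + 2 := by
  revert i m; decide

/-- Barycentric coordinates, listed cyclically from the vertex `i` with indices modulo 3, so that
all corners are treated alike. -/
theorem mem_region_iff (T : Affine.Triangle ℝ Plane) (i : Fin 3) {x : Plane} :
    x ∈ region T ↔ ∃ a b c : ℝ, 0 ≤ a ∧ 0 ≤ b ∧ 0 ≤ c ∧ a + b + c = 1 ∧
      a • T.points i + b • T.points (i + 1) + c • T.points (i + 2) = x := by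
  constructor
  · intro hx
    let S : Set Plane := {x | ∃ a b c : ℝ, 0 ≤ a ∧ 0 ≤ b ∧ 0 ≤ c ∧ a + b + c = 1 ∧
      a • T.points i + b • T.points (i + 1) + c • T.points (i + 2) = x}
    refine convexHull_min (t := S) ?_ ?_ hx
    · rintro _ ⟨m, rfl⟩
      rcases eq_or_eq_add_one_or_eq_add_two i m with rfl | rfl | rfl
      · exact ⟨1, 0, 0, by simp⟩
      · exact ⟨0, 1, 0, by simp⟩
      · exact ⟨0, 0, 1, by simp⟩
    · rintro _ ⟨a, b, c, ha, hb, hc, h, rfl⟩ _ ⟨a', b', c', ha', hb', hc', h', rfl⟩ s t hs ht hst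
      refine ⟨s * a + t * a', s * b + t * b', s * c + t * c', by positivity, by positivity,
        by positivity, ?_, ?_⟩
      · linear_combination s * h + t * h' + hst
      · module
  · rintro ⟨a, b, c, ha, hb, hc, h, rfl⟩
    have hm : ∀ m, T.points m ∈ region T := fun m => subset_convexHull ℝ _ (mem_range_self m)
    have hconv : Convex ℝ (region T) := convex_convexHull ℝ _
    have := hconv.sum_mem (t := Finset.univ) (w := ![a, b, c])
      (z := ![T.points i, T.points (i + 1), T.points (i + 2)])
      (by simp [Fin.forall_fin_succ, ha, hb, hc]) (by simpa [Fin.sum_univ_three] using h)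
      (by simp [Fin.forall_fin_succ, hm])
    simpa [Fin.sum_univ_three] using this

theorem eq_zero_of_edge_combination (T : Affine.Triangle ℝ Plane) (i : Fin 3) {s t : ℝ}
    (h : s • (T.points (i + 1) - T.points i) + t • (T.points (i + 2) - T.points i) = 0) :
    s = 0 ∧ t = 0 := by
  have hw : ∃ w : Fin 3 → ℝ, w (i + 1) = s ∧ w (i + 2) = t ∧ ∑ m, w m = 0 ∧
      ∑ m, w m • T.points m =
        s • (T.points (i + 1) - T.points i) + t • (T.points (i + 2) - T.points i) := by
    fin_cases i
    · refine ⟨![-s - t, s, t], rfl, rfl, by simp [Fin.sum_univ_three]; ring, ?_⟩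
      rw [Fin.sum_univ_three]
      change (-s - t) • T.points 0 + s • T.points 1 + t • T.points 2 =
        s • (T.points 1 - T.points 0) + t • (T.points 2 - T.points 0)
      module
    · refine ⟨![t, -s - t, s], rfl, rfl, by simp [Fin.sum_univ_three], ?_⟩
      rw [Fin.sum_univ_three]
      change t • T.points 0 + (-s - t) • T.points 1 + s • T.points 2 =
        s • (T.points 2 - T.points 1) + t • (T.points 0 - T.points 1)
      module
    · refine ⟨![s, t, -s - t], rfl, rfl, by simp [Fin.sum_univ_three], ?_⟩
      rw [Fin.sum_univ_three]
      change s • T.points 0 + t • T.points 1 + (-s - t) • T.points 2 =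
        s • (T.points 0 - T.points 2) + t • (T.points 1 - T.points 2)
      module
  obtain ⟨w, hw1, hw2, hw0, hws⟩ := hw
  have := affineIndependent_iff.mp T.independent Finset.univ w hw0 (hws.trans h)
  exact ⟨hw1 ▸ this _ (Finset.mem_univ _), hw2 ▸ this _ (Finset.mem_univ _)⟩

/-- The linear parametrization of the corner parallelogram of a triangle at the vertex `i`, which is
spanned by two half edges. -/
theorem exists_corner_equiv (T : Affine.Triangle ℝ Plane) (i : Fin 3) :
    ∃ M : (ℝ × ℝ) ≃L[ℝ] Plane, ∀ z : ℝ × ℝ, M z =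
      (z.1 / 2) • (T.points (i + 1) - T.points i) + (z.2 / 2) • (T.points (i + 2) - T.points i) := by
  let f : ℝ × ℝ →ₗ[ℝ] Plane :=
    { toFun := fun z => (z.1 / 2) • (T.points (i + 1) - T.points i)
        + (z.2 / 2) • (T.points (i + 2) - T.points i)
      map_add' := fun x y => by simp only [Prod.fst_add, Prod.snd_add]; module
      map_smul' := fun c x => by
        simp only [Prod.smul_fst, Prod.smul_snd, smul_eq_mul, RingHom.id_apply]; module }
  have hf : Function.Injective f := by
    rw [← LinearMap.ker_eq_bot, LinearMap.ker_eq_bot']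
    intro z hz
    obtain ⟨h1, h2⟩ := eq_zero_of_edge_combination T i hz
    ext
    · simpa using h1
    · simpa using h2
  exact ⟨(f.linearEquivOfInjective hf (by simp)).toContinuousLinearEquiv, fun z => rfl⟩

section Corner

variable {T : Affine.Triangle ℝ Plane} {M : Fin 3 → (ℝ × ℝ) ≃L[ℝ] Plane}

theorem corner_subset_region (hM : ∀ i z, M i z = (z.1 / 2) • (T.points (i + 1) - T.points i)
      + (z.2 / 2) • (T.points (i + 2) - T.points i)) (i : Fin 3) :
    (fun z => T.points i + M i z) '' unitSquare ⊆ region T := by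
  rintro _ ⟨⟨s, t⟩, ⟨⟨hs, hs'⟩, ht, ht'⟩, rfl⟩
  simp only at hs hs' ht ht'
  refine (mem_region_iff T i).mpr ⟨1 - (s + t) / 2, s / 2, t / 2, by linarith, by linarith,
    by linarith, by ring, ?_⟩
  simp only [hM]
  module

/-- The corner parallelogram at a vertex consists of the points of the triangle whose other two
barycentric coordinates are at most $1/2$, and at most one coordinate can exceed $1/2$. -/
theorem region_subset_iUnion_corner (hM : ∀ i z, M i z =
      (z.1 / 2) • (T.points (i + 1) - T.points i)
      + (z.2 / 2) • (T.points (i + 2) - T.points i)) :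
    region T ⊆ ⋃ i, (fun z => T.points i + M i z) '' unitSquare := by
  intro x hx
  obtain ⟨a, b, c, ha, hb, hc, h, rfl⟩ := (mem_region_iff T 0).mp hx
  rw [mem_iUnion]
  by_cases hb2 : b ≤ 1 / 2
  · by_cases hc2 : c ≤ 1 / 2
    · refine ⟨0, (2 * b, 2 * c), ⟨⟨by simpa, ?_⟩, by simpa, ?_⟩, ?_⟩
      · change 2 * b ≤ 1; linarith
      · change 2 * c ≤ 1; linarith
      · obtain rfl : a = 1 - b - c := by linarith
        simp only [hM]
        module
    · refine ⟨2, (2 * a, 2 * b), ⟨⟨by simpa, ?_⟩, by simpa, ?_⟩, ?_⟩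
      · change 2 * a ≤ 1; linarith
      · change 2 * b ≤ 1; linarith
      · obtain rfl : c = 1 - a - b := by linarith
        simp only [hM]
        change T.points 2 + ((2 * a / 2) • (T.points 0 - T.points 2)
          + (2 * b / 2) • (T.points 1 - T.points 2)) = a • T.points 0 + b • T.points 1
          + (1 - a - b) • T.points 2
        module
  · refine ⟨1, (2 * c, 2 * a), ⟨⟨by simpa, ?_⟩, by simpa, ?_⟩, ?_⟩
    · change 2 * c ≤ 1; linarith
    · change 2 * a ≤ 1; linarith
    · obtain rfl : b = 1 - a - c := by linarith
      simp only [hM]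
      change T.points 1 + ((2 * c / 2) • (T.points 2 - T.points 1)
        + (2 * a / 2) • (T.points 0 - T.points 1)) = a • T.points 0 + (1 - a - c) • T.points 1
        + c • T.points 2
      module

/-- Two points of the ball at distance $r$ in the direction of $g$ have barycentric coordinates that
differ by at most 1. Their difference is thus a combination of the half edges with coefficients of
size at most 2; pair it with $g$. -/
theorem norm_le_of_ball_subset_region (hM : ∀ i z, M i z =
      (z.1 / 2) • (T.points (i + 1) - T.points i)
      + (z.2 / 2) • (T.points (i + 2) - T.points i)) {z : Plane} {r : ℝ} (hr : 0 < r)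
    (hball : Metric.ball z r ⊆ region T) (i : Fin 3) (g : Plane) :
    r / 2 * ‖g‖ ≤ |inner ℝ g (M i (1, 0))| + |inner ℝ g (M i (0, 1))| := by
  rcases eq_or_ne g 0 with rfl | hg
  · simp
  have hg' : 0 < ‖g‖ := norm_pos_iff.mpr hg
  have hmem : ∀ σ : ℝ, |σ| = r / 2 → z + (σ / ‖g‖) • g ∈ region T := by
    intro σ hσ
    apply hball
    rw [mem_ball_iff_norm, add_sub_cancel_left, norm_smul, norm_div, norm_norm,
      div_mul_cancel₀ _ hg'.ne', Real.norm_eq_abs, hσ]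
    linarith
  obtain ⟨a, b, c, ha, hb, hc, h, hx⟩ := (mem_region_iff T i).mp
    (hmem (r / 2) (abs_of_pos (by linarith)))
  obtain ⟨a', b', c', ha', hb', hc', h', hx'⟩ := (mem_region_iff T i).mp
    (hmem (-(r / 2)) (by rw [abs_neg, abs_of_pos (by linarith)]))
  have key : (r / ‖g‖) • g = (2 * (b - b')) • M i (1, 0) + (2 * (c - c')) • M i (0, 1) := by
    have e1 : (r / ‖g‖) • g = (z + (r / 2 / ‖g‖) • g) - (z + (-(r / 2) / ‖g‖) • g) := by module
    obtain rfl : a = 1 - b - c := by linarith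
    obtain rfl : a' = 1 - b' - c' := by linarith
    rw [e1, ← hx, ← hx', hM, hM]
    module
  have e2 := congrArg (fun v => inner ℝ g v) key
  simp only [inner_add_right, inner_smul_right, real_inner_self_eq_norm_sq] at e2
  have e3 : r / ‖g‖ * ‖g‖ ^ 2 = r * ‖g‖ := by field_simp
  have hb1 : |b - b'| ≤ 1 := abs_le.mpr ⟨by linarith, by linarith⟩
  have hc1 : |c - c'| ≤ 1 := abs_le.mpr ⟨by linarith, by linarith⟩
  rw [e3] at e2
  set X := inner ℝ g (M i (1, 0))
  set Y := inner ℝ g (M i (0, 1))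
  have hX : (b - b') * X ≤ |X| := (le_abs_self _).trans <| by
    rw [abs_mul]; exact mul_le_of_le_one_left (abs_nonneg _) hb1
  have hY : (c - c') * Y ≤ |Y| := (le_abs_self _).trans <| by
    rw [abs_mul]; exact mul_le_of_le_one_left (abs_nonneg _) hc1
  linarith

end Corner

/-! ### Counting the triangles and summing up -/

/-- The number of nonoverlapping sets that contain large balls is bounded. -/
theorem card_mul_sq_le {ι : Type*} {s : Finset ι} {z : ι → Plane} {δ h : ℝ} (hδ : 0 ≤ δ)
    (hh : 0 < h) (hdisj : (s : Set ι).PairwiseDisjoint fun i => Metric.ball (z i) (δ * h))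
    {x : Plane} (hsub : ∀ i ∈ s, Metric.ball (z i) (δ * h) ⊆ Metric.closedBall x h) :
    s.card * δ ^ 2 ≤ 1 := by
  have h1 : volume (⋃ i ∈ s, Metric.ball (z i) (δ * h)) ≤ volume (Metric.closedBall x h) :=
    measure_mono (iUnion₂_subset hsub)
  rw [measure_biUnion_finset hdisj fun _ _ => measurableSet_ball] at h1
  have hδh : 0 ≤ δ * h := by positivity
  simp only [Measure.addHaar_ball volume _ hδh, Measure.addHaar_closedBall volume _ hh.le,
    Finset.sum_const, nsmul_eq_mul, finrank_euclideanSpace_fin] at h1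
  rw [← mul_assoc] at h1
  have hpos : volume (Metric.ball (0 : Plane) 1) ≠ 0 := (Metric.measure_ball_pos _ _ one_pos).ne'
  have hfin : volume (Metric.ball (0 : Plane) 1) ≠ ⊤ := measure_ball_lt_top.ne
  rw [ENNReal.mul_le_mul_iff_left hpos hfin, ← ENNReal.ofReal_natCast,
    ← ENNReal.ofReal_mul (by positivity), ENNReal.ofReal_le_ofReal_iff (by positivity)] at h1
  have h2 : (s.card * δ ^ 2) * h ^ 2 ≤ 1 * h ^ 2 := by rw [one_mul]; linarith
  exact le_of_mul_le_mul_right h2 (by positivity)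

theorem l2Norm_sq (E : Set Plane) (f : Plane → ℝ) :
    l2Norm E f ^ 2 = ∫⁻ x in E, ‖f x‖ₑ ^ 2 := by
  have := eLpNorm_nnreal_pow_eq_lintegral (f := f) (μ := volume.restrict E) (p := 2) two_ne_zero
  simpa [l2Norm] using this

/-- The inverse estimate, with the `L²` norm taken over a triangle. -/
theorem exists_lintegral_region_le_negNorm : ∃ K : ℝ, 0 < K ∧
    ∀ (p : ℕ) (q : MvPolynomial (Fin 2) ℝ), q.totalDegree ≤ p →
    ∀ (T : Affine.Triangle ℝ Plane) (z : Plane) (r : ℝ), 0 < r → Metric.ball z r ⊆ region T →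
    ∀ E : Set Plane, interior (region T) ⊆ E →
    ∫⁻ x in region T, ‖polyFun q x‖ₑ ^ 2 ≤
      3 * (ENNReal.ofReal (K * ((p : ℝ) + 1) ^ 2 / r) * negNorm E (polyFun q)) ^ 2 := by
  obtain ⟨K, hK, H⟩ := exists_lintegral_parallelogram_le_negNorm
  refine ⟨2 * K, by positivity, fun p q hq T z r hr hball E hE => ?_⟩
  choose M hM using exists_corner_equiv T
  have hi : ∀ i, ∫⁻ x in (fun z => T.points i + M i z) '' unitSquare, ‖polyFun q x‖ₑ ^ 2 ≤
      (ENNReal.ofReal (2 * K * ((p : ℝ) + 1) ^ 2 / r) * negNorm E (polyFun q)) ^ 2 := by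
    intro i
    -- The thickness `r / 2` of the corner parallelograms accounts for the factor 2 in the constant.
    have h := H p q hq (T.points i) (M i) (r / 2) (by positivity)
      (norm_le_of_ball_subset_region hM hr hball i) E ?_
    · rwa [show K * ((p : ℝ) + 1) ^ 2 / (r / 2) = 2 * K * ((p : ℝ) + 1) ^ 2 / r by
        field_simp] at h
    · refine Subset.trans (interior_maximal ?_ ?_) hE
      · exact (image_mono (Set.prod_mono Ioo_subset_Icc_self Ioo_subset_Icc_self)).trans
          (corner_subset_region hM i)
      · exact ((M i).toHomeomorph.trans (Homeomorph.addLeft (T.points i))).isOpenMap _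
          (isOpen_Ioo.prod isOpen_Ioo)
  calc _ ≤ ∫⁻ x in ⋃ i, (fun z => T.points i + M i z) '' unitSquare, ‖polyFun q x‖ₑ ^ 2 :=
        lintegral_mono_set (region_subset_iUnion_corner hM)
    _ ≤ ∑' i, ∫⁻ x in (fun z => T.points i + M i z) '' unitSquare, ‖polyFun q x‖ₑ ^ 2 :=
        lintegral_iUnion_le _ _
    _ ≤ ∑ _i : Fin 3,
        (ENNReal.ofReal (2 * K * ((p : ℝ) + 1) ^ 2 / r) * negNorm E (polyFun q)) ^ 2 := by
        rw [tsum_fintype]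
        exact Finset.sum_le_sum fun i _ => hi i
    _ = _ := by simp

end InverseEstimate

theorem mainTheorem3 (γ κ : ℝ) (hγ : 0 < γ) (hκ : 0 < κ) :
    ∃ c : ℝ, 0 < c ∧
      ∀ E : Set InverseEstimate.Plane, InverseEstimate.IsPolygon E →
      ∀ 𝒯 : Finset (Affine.Triangle ℝ InverseEstimate.Plane),
        InverseEstimate.IsSubtriangulation 𝒯 E →
        (∀ T ∈ 𝒯, InverseEstimate.IsStarShapedWrtBall (InverseEstimate.region T)
          (γ * Metric.diam (InverseEstimate.region T))) →
        (∀ T ∈ 𝒯, κ * Metric.diam E ≤ Metric.diam (InverseEstimate.region T)) →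
      ∀ (p : ℕ) (q : MvPolynomial (Fin 2) ℝ), q.totalDegree ≤ p →
        InverseEstimate.l2Norm E (InverseEstimate.polyFun q) ≤
          ENNReal.ofReal (c * ((p : ℝ) + 1) ^ 2 / Metric.diam E) *
            InverseEstimate.negNorm E (InverseEstimate.polyFun q) := by
  obtain ⟨K, hK, H⟩ := InverseEstimate.exists_lintegral_region_le_negNorm
  -- One factor $1/(\gamma\kappa)$ comes from the inscribed radius $\gamma\kappa h$, the other from
  -- the square root of the number of triangles; the 2 dominates the $\sqrt3$ from the three
  -- corners.
  refine ⟨2 * K / (γ * κ) ^ 2, by positivity, fun E hE 𝒯 h𝒯 hstar hdiam p q hq => ?_⟩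
  obtain ⟨x, hx⟩ := hE.isConnected.nonempty
  set h := Metric.diam E
  have hpos : 0 < h := by
    refine Metric.diam_pos ?_ hE.isBounded
    exact (infinite_of_mem_nhds x (hE.isOpen.mem_nhds hx)).nontrivial
  have hr : 0 < γ * κ * h := by positivity
  have hball : ∀ T ∈ 𝒯, ∃ z, Metric.ball z (γ * κ * h) ⊆ InverseEstimate.region T := by
    intro T hT
    obtain ⟨z, r, hr, hz⟩ := hstar T hT
    refine ⟨z, fun y hy => (hz y (Metric.ball_subset_ball ?_ hy)).1⟩
    refine le_trans ?_ hr
    rw [mul_assoc]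
    exact mul_le_mul_of_nonneg_left (hdiam T hT) hγ.le
  choose! z hz using hball
  have hregion : ∀ T ∈ 𝒯, InverseEstimate.region T ⊆ closure E := fun T hT =>
    h𝒯.cover ▸ subset_biUnion_of_mem (u := InverseEstimate.region) hT
  have hcard : 𝒯.card * (γ * κ) ^ 2 ≤ 1 := by
    refine InverseEstimate.card_mul_sq_le (z := z) (x := x) (by positivity) hpos ?_ ?_
    · intro S hS T hT hST
      exact (h𝒯.nonoverlapping hS hT hST).mono
        (interior_maximal (hz S hS) Metric.isOpen_ball)
        (interior_maximal (hz T hT) Metric.isOpen_ball)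
    · intro T hT
      refine (hz T hT).trans ((hregion T hT).trans (closure_minimal ?_ Metric.isClosed_closedBall))
      exact fun y hy => Metric.dist_le_diam_of_mem hE.isBounded hy hx
  set N := InverseEstimate.negNorm E (InverseEstimate.polyFun q)
  rw [← ENNReal.pow_le_pow_left_iff two_ne_zero, InverseEstimate.l2Norm_sq]
  have hT : ∀ T ∈ 𝒯, ∫⁻ x in InverseEstimate.region T, ‖InverseEstimate.polyFun q x‖ₑ ^ 2 ≤
      3 * (ENNReal.ofReal (K * ((p : ℝ) + 1) ^ 2 / (γ * κ * h)) * N) ^ 2 := fun T hT => by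
    refine H p q hq T (z T) _ hr (hz T hT) E ?_
    -- The absence of slits puts the open triangle inside `E`, not merely inside its closure.
    have := interior_mono (hregion T hT)
    rwa [hE.interior_closure] at this
  calc ∫⁻ x in E, ‖InverseEstimate.polyFun q x‖ₑ ^ 2
      ≤ ∫⁻ x in ⋃ T : 𝒯, InverseEstimate.region T, ‖InverseEstimate.polyFun q x‖ₑ ^ 2 := by
        refine lintegral_mono_set (subset_closure.trans ?_)
        rw [← h𝒯.cover, iUnion_subtype]
    _ ≤ ∑' T : 𝒯, ∫⁻ x in InverseEstimate.region T, ‖InverseEstimate.polyFun q x‖ₑ ^ 2 :=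
        lintegral_iUnion_le _ _
    _ ≤ ∑ _T : 𝒯, 3 * (ENNReal.ofReal (K * ((p : ℝ) + 1) ^ 2 / (γ * κ * h)) * N) ^ 2 := by
        rw [tsum_fintype]
        exact Finset.sum_le_sum fun T _ => hT T T.2
    _ = ENNReal.ofReal (𝒯.card * (3 * (K * ((p : ℝ) + 1) ^ 2 / (γ * κ * h)) ^ 2)) * N ^ 2 := by
        rw [Finset.sum_const, Finset.card_univ, Fintype.card_coe, nsmul_eq_mul, mul_pow,
          ENNReal.ofReal_mul (by positivity), ENNReal.ofReal_mul (by positivity),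
          ENNReal.ofReal_pow (by positivity), ENNReal.ofReal_natCast, ENNReal.ofReal_ofNat]
        ring
    _ ≤ ENNReal.ofReal ((2 * K / (γ * κ) ^ 2 * ((p : ℝ) + 1) ^ 2 / h) ^ 2) * N ^ 2 := by
        gcongr
        have e : (2 * K / (γ * κ) ^ 2 * ((p : ℝ) + 1) ^ 2 / h) ^ 2 =
            1 / (γ * κ) ^ 2 * (4 * (K * ((p : ℝ) + 1) ^ 2 / (γ * κ * h)) ^ 2) := by
          field_simp
          ring
        rw [e]
        gcongr
        · rwa [le_div_iff₀ (by positivity)]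
        · norm_num
    _ = _ := by
        rw [ENNReal.ofReal_pow (by positivity), ← mul_pow]
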